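/- Let $d\in\{2,3\}$ and let $\sigma$ be a real number. There exist constants $c_0,c_1>0$, depending only on $d$ and $\sigma$, such that the following holds. Let $\Omega\subset\mathbb R^d$ be an open set with $\Omega=\operatorname{int}\overline\Omega$ (for example, a bounded Lipschitz domain). Let $\mathcal T_h$ be a finite conforming triangulation by closed simplices with $\bigcup_{K\in\mathcal T_h}K=\overline\Omega$, and put $h_K=\operatorname{diam}K$, $h=\max_{K\in\mathcal T_h}h_K$. Assume that $\mathcal T_h$ is shape regular with constant $\sigma$: every $K\in\mathcal T_h$ contains a ball of some diameter $\rho_K>0$ with $h_K\le\sigma\rho_K$. Let $\Omega_k\subset\Omega$ be nonempty (for example, one of the two parts into which an interface divides $\Omega$), let $\delta\ge 0$, and define $$\mathcal T_{h,k}=\{K\in\mathcal T_h:\ \exists\,x\in K,\ \operatorname{dist}(x,\Omega_k)\le\delta\},\qquad \Omega_{h,k}=\operatorname{int}\bigcup_{K\in\mathcal T_{h,k}}K .$$ Let $V_{h,k}$ be the space of continuous functions that are affine on every $K\in\mathcal T_{h,k}$ and vanish on $\partial\Omega\cap\partial\Omega_{h,k}$. Let $x_j$, $j=1,\dots,N$,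 be the vertices of the simplices in $\mathcal T_{h,k}$ that do not lie on $\partial\Omega\cap\partial\Omega_{h,k}$, and let $\varphi_j$ be the corresponding nodal basis functions of $V_{h,k}$ (hat functions). For $\mathbf v\in L^2(\Omega_{h,k})^d$ let $$\mathcal P_k\mathbf v=\sum_{j=1}^N \frac{\int_{\Omega_{h,k}}\varphi_j\,\mathbf v\,dx}{\int_{\Omega_{h,k}}\varphi_j\,dx}\;\varphi_j .$$ Let $K_1\neq K_2$ be simplices of $\mathcal T_{h,k}$ that share a $(d-1)$-dimensional face $f$, put $\omega(f)=K_1\cup K_2$ and $h_f=\max\{h_{K_1},h_{K_2}\}$, and define $$s^f_{h,k}(u,v)=\int_{\omega(f)}(\nabla u-\mathcal P_k\nabla u)\cdot(\nabla v-\mathcal P_k\nabla v)\,dx+h_f^2\int_{\omega(f)}(\nabla\mathcal P_k\nabla u):(\nabla\mathcal P_k\nabla v)\,dx .$$ Then $$c_1\|\nabla u\|^2_{L^2(K_2)}\le\|\nabla u\|^2_{L^2(K_1)}+s^f_{h,k}(u,u)\qquad\text{for all }u\in H^1(\Omega_{h,k}),$$ $$c_0\|u_h\|^2_{L^2(K_2)}\le\|u_h\|^2_{L^2(K_1)}+h^2\,s^f_{h,k}(u_h,u_h)\qquad\text{for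 all }u_h\in V_{h,k}.$$ -/

import Mathlib

open MeasureTheory Set

open scoped ContDiff

noncomputable section

namespace PG

/-- Euclidean space `ℝ^d`. -/
abbrev Pt (d : ℕ) : Type := EuclideanSpace ℝ (Fin d)

variable {d : ℕ}

/-! ### Sobolev space `H¹` and weak gradients -/

/-- `g` is a weak gradient of `u` on `U`. -/
def IsWeakGrad (U : Set (Pt d)) (u : Pt d → ℝ) (g : Pt d → Pt d) : Prop :=
  ∀ φ : Pt d → ℝ, ContDiff ℝ ∞ φ → HasCompactSupport φ → tsupport φ ⊆ U →
    ∫ x in U, u x • gradient φ x = -∫ x in U, φ x • g x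

/-- `u ∈ H¹(U)`: both `u` and a weak gradient of `u` are square integrable on `U`. -/
def MemH1 (U : Set (Pt d)) (u : Pt d → ℝ) : Prop :=
  MemLp u 2 (volume.restrict U) ∧
    ∃ g : Pt d → Pt d, MemLp g 2 (volume.restrict U) ∧ IsWeakGrad U u g

open Classical in
/-- The weak gradient `∇u` on `U` of `u ∈ H¹(U)` (unique up to a null set when `U` is open). -/
def weakGrad (U : Set (Pt d)) (u : Pt d → ℝ) : Pt d → Pt d :=
  if h : MemH1 U u then h.2.choose else 0

/-! ### Triangulations -/

/-- The closed simplex with vertex set `K`. -/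
def simplex (K : Finset (Pt d)) : Set (Pt d) := convexHull ℝ (K : Set (Pt d))

/-- The mesh cells: the `d`-dimensional simplices of the complex, given by their vertex sets. -/
def cells (T : Geometry.SimplicialComplex ℝ (Pt d)) : Set (Finset (Pt d)) :=
  {K | K ∈ T.faces ∧ K.card = d + 1}

/-- A (finite, conforming) triangulation of `Ω`, fitted to `Ω`. Conformity is part of
`Geometry.SimplicialComplex`: two simplices meet exactly in the simplex spanned by their common
vertices. -/
structure IsTriangulation (T : Geometry.SimplicialComplex ℝ (Pt d)) (Ω : Set (Pt d)) :
    Prop where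
  finite : T.faces.Finite
  pure : ∀ F ∈ T.faces, ∃ K ∈ cells T, F ⊆ K
  fitted : ⋃ K ∈ cells T, simplex K = closure Ω

/-- The diameter `h_K` of a cell. -/
def cellDiam (K : Finset (Pt d)) : ℝ := Metric.diam (simplex K)

/-- The mesh size `h = max_K h_K`. -/
def meshSize (T : Geometry.SimplicialComplex ℝ (Pt d)) : ℝ :=
  sSup (cellDiam '' cells T)

/-- Shape regularity with constant `σ`: every cell `K` contains a ball of diameter `ρ`
with `h_K ≤ σ ρ`. -/
def ShapeRegular (T : Geometry.SimplicialComplex ℝ (Pt d)) (σ : ℝ) : Prop :=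
  ∀ K ∈ cells T, ∃ (c : Pt d) (r : ℝ), 0 < r ∧
    Metric.closedBall c r ⊆ simplex K ∧ cellDiam K ≤ σ * (2 * r)

/-- The sub-triangulation `T_{h,k}(δ)` of the cells that meet the closed `δ`-neighbourhood of
the subdomain `Ωk`. -/
def subMesh (T : Geometry.SimplicialComplex ℝ (Pt d)) (Ωk : Set (Pt d)) (δ : ℝ) :
    Set (Finset (Pt d)) :=
  {K | K ∈ cells T ∧ ∃ x ∈ simplex K, Metric.infDist x Ωk ≤ δ}

/-- The open region `int (⋃ K)` covered by a set of cells. -/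
def region (M : Set (Finset (Pt d))) : Set (Pt d) := interior (⋃ K ∈ M, simplex K)

/-! ### Linear finite elements on a set `M` of cells of a triangulation of `Ω` -/

/-- The space `V_{h,k}` (degree one): continuous, affine on each cell, zero on the part of the
boundary of `Ω` that belongs to the boundary of the region. -/
def feSpace (Ω : Set (Pt d)) (M : Set (Finset (Pt d))) : Set (Pt d → ℝ) :=
  {v | ContinuousOn v (region M) ∧
    (∀ K ∈ M, ∃ a : Pt d →ᵃ[ℝ] ℝ, EqOn v a (simplex K)) ∧
    ∀ x ∈ frontier Ω ∩ frontier (region M), v x = 0}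

/-- The nodes of `V_{h,k}`: the vertices of the cells off the Dirichlet boundary. -/
def nodes (Ω : Set (Pt d)) (M : Set (Finset (Pt d))) : Set (Pt d) :=
  {x | (∃ K ∈ M, x ∈ K) ∧ x ∉ frontier Ω ∩ frontier (region M)}

/-- `w` is the family of barycentric coordinates of `y` in the simplex with vertex set `K`,
extended by zero to points that are not vertices of `K`. -/
def IsBary (K : Finset (Pt d)) (y : Pt d) (w : Pt d → ℝ) : Prop :=
  (∀ v ∈ K, 0 ≤ w v) ∧ (∀ v, v ∉ K → w v = 0) ∧ ∑ v ∈ K, w v = 1 ∧ ∑ v ∈ K, w v • v = y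

open Classical in
/-- The nodal (hat) function `φ_x` of the vertex `x`: at a point `y` of a cell it is the
barycentric coordinate of `y` at `x` (the coordinates do not depend on the cell containing `y`,
by conformity); it is zero outside the cells. -/
def hat (M : Set (Finset (Pt d))) (x y : Pt d) : ℝ :=
  if h : ∃ w : Pt d → ℝ, ∃ K ∈ M, IsBary K y w then h.choose x else 0

/-- The coefficient `g_x(v) = ∫ v φ_x / ∫ φ_x` of the lumped-mass projection. -/
def lumpedCoeff (M : Set (Finset (Pt d))) (v : Pt d → Pt d) (x : Pt d) : Pt d :=
  (∫ y in region M, hat M x y)⁻¹ • ∫ y in region M, hat M x y • v y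

/-- The lumped-mass `L²` projection `P_k v = ∑_x g_x(v) φ_x` into `(V_{h,k})^d`. -/
def lumpedProj (Ω : Set (Pt d)) (M : Set (Finset (Pt d))) (v : Pt d → Pt d) : Pt d → Pt d :=
  fun y => ∑ᶠ x ∈ nodes Ω M, hat M x y • lumpedCoeff M v x

/-- `∇u` on the region of `M`. -/
def grad (M : Set (Finset (Pt d))) (u : Pt d → ℝ) : Pt d → Pt d := weakGrad (region M) u

/-- `P_k ∇u`. -/
def projGrad (Ω : Set (Pt d)) (M : Set (Finset (Pt d))) (u : Pt d → ℝ) : Pt d → Pt d :=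
  lumpedProj Ω M (grad M u)

/-- The local stabilization form on the patch `ω(f) = K ∪ K'`:
`∫ (∇u - P_k∇u)·(∇v - P_k∇v) + h_f² ∫ (∇P_k∇u) : (∇P_k∇v)`, with `h_f = max h_K h_K'`. -/
def localStab (Ω : Set (Pt d)) (M : Set (Finset (Pt d))) (K K' : Finset (Pt d))
    (u v : Pt d → ℝ) : ℝ :=
  (∫ x in simplex K ∪ simplex K',
      inner ℝ (grad M u x - projGrad Ω M u x) (grad M v x - projGrad Ω M v x)) +
    max (cellDiam K) (cellDiam K') ^ 2 *
      ∫ x in simplex K ∪ simplex K',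
        ∑ i : Fin d, inner ℝ (grad M (fun y => projGrad Ω M u y i) x)
          (grad M (fun y => projGrad Ω M v y i) x)

/-- `K₁` and `K₂` are the two distinct cells of `M` sharing the facet with vertex set `f`. -/
def SharesFace (M : Set (Finset (Pt d))) (K₁ K₂ f : Finset (Pt d)) : Prop :=
  K₁ ∈ M ∧ K₂ ∈ M ∧ K₁ ≠ K₂ ∧ f.card = d ∧ f ⊆ K₁ ∧ f ⊆ K₂

end PG

end

noncomputable section

namespace PG

/-! Let `p = P_k ∇u`. Each component of `p` is affine on every closed cell, and `p` has a single
value at a common vertex `a` of `K₁` and `K₂`. For `x ∈ K₁` and `y ∈ K₂` write `p y = p x + (p a - p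
x) + (p y - p a)`. The two increments are at most diameter times gradient, so squaring, averaging
over `x` and integrating over `y` bounds `‖p‖²` on `K₂` by `‖p‖²` on `K₁` plus `h_f² ‖∇p‖²`, which
is the second term of the stabilization. Exchanging `p` for `∇u` on either cell costs only the first
term. This gives the gradient estimate. For a finite element function the same transfer is applied
to `v` itself (`AffineOnCells.integral_sq_le`). It leaves `h_K² ‖∇v‖²` on both cells. On `K₁` this
is absorbed by the inverse inequality; on `K₂` the gradient estimate first moves it to `K₁`. Shape
regularity enters through `ComparableCells`: a shared edge makes the two diameters, hence the two
volumes, comparable. Since `grad` is a chosen weak gradient, it must also be shown that piecewise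
affine functions are in `H¹` and that their weak gradient on a cell is almost everywhere the
constant classical one. -/

variable {d : ℕ}

/-! ### Barycentric coordinates and nodal functions -/

/-- Barycentric coordinates of a cell, as affine maps on the whole space. -/
theorem exists_barycentric {K : Finset (Pt d)}
    (hind : AffineIndependent ℝ ((↑) : K → Pt d)) (hcard : K.card = d + 1) :
    ∃ lam : Pt d → (Pt d →ᵃ[ℝ] ℝ), (∀ v ∈ K, lam v v = 1) ∧
      (∀ v ∈ K, ∀ w ∈ K, v ≠ w → lam v w = 0) ∧ ∀ v ∉ K, lam v = 0 := by
  classical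
  have htop : affineSpan ℝ (range ((↑) : K → Pt d)) = ⊤ := by
    rw [hind.affineSpan_eq_top_iff_card_eq_finrank_add_one]
    simp [hcard]
  let b : AffineBasis K ℝ (Pt d) := ⟨(↑), hind, htop⟩
  have hb : ∀ i : K, b i = i := fun _ => rfl
  refine ⟨fun v => if h : v ∈ K then b.coord ⟨v, h⟩ else 0, ?_, ?_, ?_⟩
  · intro v hv
    simpa [hv, hb] using b.coord_apply_eq ⟨v, hv⟩
  · intro v hv w hw hvw
    have : (⟨v, hv⟩ : K) ≠ ⟨w, hw⟩ := by simpa using hvw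
    simpa [hv, hb] using b.coord_apply_ne this
  · intro v hv
    simp [hv]

/-- An affine function commutes with weighted sums whose weights add up to one. -/
theorem affineMap_sum_smul (a : Pt d →ᵃ[ℝ] ℝ) (K : Finset (Pt d)) (w : Pt d → ℝ)
    (hw : ∑ v ∈ K, w v = 1) : a (∑ v ∈ K, w v • v) = ∑ v ∈ K, w v * a v := by
  obtain ⟨c, h⟩ : ∃ c, ∀ y, a y = a.linear y + c := ⟨a 0, fun y => by
    conv_lhs => rw [a.decomp]
    simp⟩
  simp only [h, map_sum, map_smul, smul_eq_mul, mul_add, Finset.sum_add_distrib,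
    ← Finset.sum_mul, hw, one_mul]

theorem IsBary.eq_coord {K : Finset (Pt d)} {y : Pt d} {w : Pt d → ℝ} (hw : IsBary K y w)
    {lam : Pt d → (Pt d →ᵃ[ℝ] ℝ)} (h1 : ∀ v ∈ K, lam v v = 1)
    (h0 : ∀ v ∈ K, ∀ w ∈ K, v ≠ w → lam v w = 0) (hout : ∀ v ∉ K, lam v = 0) (x : Pt d) :
    w x = lam x y := by
  obtain ⟨-, hw0, hw1, hwy⟩ := hw
  by_cases hx : x ∈ K
  · rw [← hwy, affineMap_sum_smul _ _ _ hw1, Finset.sum_eq_single_of_mem x hx, h1 x hx, mul_one]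
    intro b hb hbx
    rw [h0 x hx b hb hbx.symm, mul_zero]
  · simp [hw0 x hx, hout x hx]

theorem IsBary.mem_simplex {K : Finset (Pt d)} {y : Pt d} {w : Pt d → ℝ} (hw : IsBary K y w) :
    y ∈ simplex K := by
  obtain ⟨hp, -, hw1, hwy⟩ := hw
  rw [← hwy]
  exact (convex_convexHull ℝ _).sum_mem hp hw1 fun v hv => subset_convexHull ℝ _ hv

theorem exists_isBary {K : Finset (Pt d)} {y : Pt d} (hy : y ∈ simplex K) :
    ∃ w, IsBary K y w := by
  classical
  rw [simplex, Finset.convexHull_eq] at hy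
  obtain ⟨w, hp, hw1, hwy⟩ := hy
  refine ⟨fun v => if v ∈ K then w v else 0, ?_, ?_, ?_, ?_⟩
  · intro v hv
    simpa [hv] using hp v hv
  · intro v hv
    simp [hv]
  · rw [← hw1]
    exact Finset.sum_congr rfl fun v hv => by simp [hv]
  · rw [Finset.centerMass_eq_of_sum_1 _ _ hw1] at hwy
    rw [← hwy]
    exact Finset.sum_congr rfl fun v hv => by simp [hv]

theorem IsBary.mono {K L : Finset (Pt d)} {y : Pt d} {w : Pt d → ℝ} (hw : IsBary K y w)
    (hKL : K ⊆ L) : IsBary L y w := by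
  obtain ⟨hp, hw0, hw1, hwy⟩ := hw
  refine ⟨fun v _ => ?_, fun v hv => hw0 v fun h => hv (hKL h), ?_, ?_⟩
  · by_cases h : v ∈ K
    · exact hp v h
    · exact (hw0 v h).ge
  · rw [← hw1]
    exact (Finset.sum_subset hKL fun v _ hv => hw0 v hv).symm
  · rw [← hwy]
    exact (Finset.sum_subset hKL fun v _ hv => by simp [hw0 v hv]).symm

theorem IsBary.unique {K : Finset (Pt d)} (hind : AffineIndependent ℝ ((↑) : K → Pt d))
    (hcard : K.card = d + 1) {y : Pt d} {w w' : Pt d → ℝ} (hw : IsBary K y w)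
    (hw' : IsBary K y w') : w = w' := by
  obtain ⟨lam, h1, h0, hout⟩ := exists_barycentric hind hcard
  funext x
  rw [hw.eq_coord h1 h0 hout, hw'.eq_coord h1 h0 hout]

/-- The nodal functions of a conforming mesh are affine on every cell. -/
theorem exists_hat_eqOn {T : Geometry.SimplicialComplex ℝ (Pt d)} {M : Set (Finset (Pt d))}
    (hM : M ⊆ cells T) {K : Finset (Pt d)} (hK : K ∈ M) (x : Pt d) :
    ∃ a : Pt d →ᵃ[ℝ] ℝ, EqOn (hat M x) a (simplex K) := by
  classical
  obtain ⟨lam, h1, h0, hout⟩ := exists_barycentric (T.indep (hM hK).1) (hM hK).2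
  refine ⟨lam x, fun y hy => ?_⟩
  obtain ⟨w, hw⟩ := exists_isBary hy
  have hex : ∃ w : Pt d → ℝ, ∃ K ∈ M, IsBary K y w := ⟨w, K, hK, hw⟩
  rw [hat, dif_pos hex]
  -- The weights chosen in `hat` may come from a cell `L` other than `K`. By conformity `y` lies in
  -- the simplex on the common vertices; its weights there, extended by zero, are the unique weights
  -- for both cells.
  obtain ⟨L, hL, hwL⟩ := hex.choose_spec
  have hmem : y ∈ simplex (K ∩ L) := by
    have := T.inter_subset_convexHull (hM hK).1 (hM hL).1 ⟨hy, hwL.mem_simplex⟩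
    simpa [simplex] using this
  obtain ⟨w', hw'⟩ := exists_isBary hmem
  have e1 := hwL.unique (T.indep (hM hL).1) (hM hL).2 (hw'.mono Finset.inter_subset_right)
  rw [e1, (hw'.mono Finset.inter_subset_left).eq_coord h1 h0 hout]

/-- `v` is affine on each of the cells of `M`. -/
def AffineOnCells (M : Set (Finset (Pt d))) (v : Pt d → ℝ) : Prop :=
  ∀ K ∈ M, ∃ a : Pt d →ᵃ[ℝ] ℝ, EqOn v a (simplex K)

/-- A finite linear combination of hat functions inherits their affineness. The estimates below use
no other property of the projection. -/
theorem affineOnCells_lumpedProj {T : Geometry.SimplicialComplex ℝ (Pt d)}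
    {M : Set (Finset (Pt d))} (hM : M ⊆ cells T) (hfin : M.Finite) (Ω : Set (Pt d))
    (g : Pt d → Pt d) (i : Fin d) : AffineOnCells M fun y => lumpedProj Ω M g y i := by
  intro K hK
  have hN : (nodes Ω M).Finite := by
    refine (hfin.biUnion fun K _ => K.finite_toSet).subset ?_
    rintro x ⟨⟨K, hK, hx⟩, -⟩
    simp only [mem_iUnion]
    exact ⟨K, hK, hx⟩
  choose a ha using fun x => exists_hat_eqOn hM hK x
  refine ⟨∑ x ∈ hN.toFinset, lumpedCoeff M g x i • a x, fun y hy => ?_⟩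
  have : lumpedProj Ω M g y = ∑ x ∈ hN.toFinset, hat M x y • lumpedCoeff M g x := by
    rw [lumpedProj, finsum_mem_eq_finite_toFinset_sum _ hN]
  simp only [this]
  have e : (∑ x ∈ hN.toFinset, lumpedCoeff M g x i • a x) y =
      ∑ x ∈ hN.toFinset, lumpedCoeff M g x i * a x y := by
    induction hN.toFinset using Finset.induction_on with
    | empty => simp
    | insert b s hb ih => rw [Finset.sum_insert hb, Finset.sum_insert hb, ← ih]; simp
  rw [e]
  simp only [WithLp.ofLp_sum, Finset.sum_apply, PiLp.smul_apply, smul_eq_mul]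
  exact Finset.sum_congr rfl fun x _ => by rw [ha x hy, mul_comm]

/-! ### Lipschitz continuity from finite closed covers -/

/-- A continuous function on an interval that is `C`-Lipschitz on each of finitely many closed
sets covering the interval satisfies the Lipschitz estimate between the end points. -/
theorem abs_sub_le_of_finite_closed_cover {f : ℝ → ℝ} (hf : Continuous f) {C : ℝ} {ι : Type*}
    {S : ι → Set ℝ} (hS : ∀ i, IsClosed (S i))
    (hC : ∀ i, ∀ x ∈ S i, ∀ y ∈ S i, |f x - f y| ≤ C * |x - y|) {b : ℝ} (s : Finset ι) :
    ∀ a ≤ b, Icc a b ⊆ ⋃ i ∈ s, S i → |f b - f a| ≤ C * (b - a) := by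
  classical
  induction s using Finset.strongInduction with
  | H s ih =>
    intro a hab hcov
    obtain ⟨i, hi, hai⟩ : ∃ i ∈ s, a ∈ S i := by simpa using hcov (left_mem_Icc.2 hab)
    -- `t` is the last point of `[a, b]` in `S i`. Beyond it the sets other than `S i` cover, so
    -- induction applies on `[x, b]` for every `x > t`; the bound at `t` itself follows by passing
    -- to the closure.
    obtain ⟨t, ⟨htS, hat, htb⟩, htmax⟩ :=
      (isCompact_Icc.inter_left (hS i)).exists_isGreatest ⟨a, hai, left_mem_Icc.2 hab⟩
    have h1 : |f t - f a| ≤ C * (t - a) := by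
      simpa [abs_of_nonneg (sub_nonneg.2 hat)] using hC i t htS a hai
    have h2 : |f b - f t| ≤ C * (b - t) := by
      rcases htb.eq_or_lt with rfl | htb'
      · simp
      have hcl : IsClosed {x | |f b - f x| ≤ C * (b - x)} :=
        isClosed_le (by fun_prop) (by fun_prop)
      have hsub : Ioc t b ⊆ {x | |f b - f x| ≤ C * (b - x)} := by
        intro x hx
        refine ih (s.erase i) (Finset.erase_ssubset hi) x hx.2 fun y hy => ?_
        have hyab : y ∈ Icc a b := ⟨hat.trans (hx.1.le.trans hy.1), hy.2⟩
        obtain ⟨j, hj, hyj⟩ : ∃ j ∈ s, y ∈ S j := by simpa using hcov hyab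
        have hji : j ≠ i := by
          rintro rfl
          exact (hx.1.trans_le hy.1).not_ge (htmax ⟨hyj, hyab⟩)
        simp only [mem_iUnion]
        exact ⟨j, Finset.mem_erase.2 ⟨hji, hj⟩, hyj⟩
      have := closure_minimal hsub hcl
      rw [closure_Ioc htb'.ne] at this
      exact this (left_mem_Icc.2 htb)
    calc |f b - f a| ≤ |f b - f t| + |f t - f a| := abs_sub_le _ _ _
      _ ≤ C * (b - a) := by linarith

/-- A function that is Lipschitz on each member of a finite closed cover is Lipschitz. -/
theorem exists_lipschitzWith_of_finite_closed_cover {F : Pt d → ℝ} {𝒮 : Set (Set (Pt d))}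
    (hfin : 𝒮.Finite) (hcl : ∀ S ∈ 𝒮, IsClosed S) (hcov : ⋃₀ 𝒮 = univ)
    (hL : ∀ S ∈ 𝒮, ∃ C, LipschitzOnWith C F S) : ∃ C, LipschitzWith C F := by
  have hcont : Continuous F := by
    have := hfin.to_subtype
    refine LocallyFinite.continuous (f := fun S : 𝒮 => (S : Set (Pt d))) (locallyFinite_of_finite _)
      (by rw [← sUnion_eq_iUnion, hcov]) (fun S => hcl S S.2) fun S => ?_
    obtain ⟨C, hC⟩ := hL S S.2
    exact hC.continuousOn
  choose! c hc using hL
  obtain ⟨C, hC⟩ : ∃ C, ∀ S ∈ 𝒮, c S ≤ C := by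
    obtain ⟨C, hC⟩ := (hfin.image c).bddAbove
    exact ⟨C, fun S hS => hC (mem_image_of_mem c hS)⟩
  refine ⟨C, LipschitzWith.of_dist_le_mul fun x y => ?_⟩
  have := hfin.fintype
  have hγ : Continuous fun t : ℝ => y + t • (x - y) := by fun_prop
  have key := abs_sub_le_of_finite_closed_cover (f := fun t : ℝ => F (y + t • (x - y)))
    (hcont.comp hγ) (C := C * dist x y) (ι := 𝒮)
    (S := fun S => (fun t : ℝ => y + t • (x - y)) ⁻¹' (S : Set (Pt d)))
    (fun S => (hcl S S.2).preimage hγ) ?_ (b := 1) Finset.univ 0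
    zero_le_one ?_
  · simpa [Real.dist_eq] using key
  · intro S s hs t ht
    have := (hc S S.2).dist_le_mul _ hs _ ht
    rw [Real.dist_eq, dist_add_left, dist_eq_norm, ← sub_smul, norm_smul, Real.norm_eq_abs,
      ← dist_eq_norm x y] at this
    refine this.trans ?_
    rw [mul_assoc, mul_comm (dist x y)]
    exact mul_le_mul_of_nonneg_right (hC S S.2) (by positivity)
  · intro t _
    have : y + t • (x - y) ∈ ⋃₀ 𝒮 := hcov ▸ mem_univ _
    obtain ⟨S, hS, hy⟩ := this
    simp only [mem_iUnion]
    exact ⟨⟨S, hS⟩, by simp, hy⟩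

/-! ### Weak gradients of piecewise affine functions -/

theorem isCompact_simplex (K : Finset (Pt d)) : IsCompact (simplex K) :=
  K.finite_toSet.isCompact_convexHull ℝ

theorem convex_simplex (K : Finset (Pt d)) : Convex ℝ (simplex K) := convex_convexHull ℝ _

theorem affine_eq_inner (a : Pt d →ᵃ[ℝ] ℝ) :
    ∃ (G : Pt d) (β : ℝ), ∀ y, a y = inner ℝ G y + β := by
  refine ⟨(InnerProductSpace.toDual ℝ (Pt d)).symm (LinearMap.toContinuousLinearMap a.linear),
    a 0, fun y => ?_⟩
  rw [InnerProductSpace.toDual_symm_apply]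
  conv_lhs => rw [a.decomp]
  simp

theorem AffineOnCells.exists_inner {M : Set (Finset (Pt d))} {v : Pt d → ℝ}
    (hv : AffineOnCells M v) :
    ∃ (G : Finset (Pt d) → Pt d) (β : Finset (Pt d) → ℝ),
      ∀ K ∈ M, ∀ y ∈ simplex K, v y = inner ℝ (G K) y + β K := by
  have : ∀ K ∈ M, ∃ (G : Pt d) (β : ℝ), ∀ y ∈ simplex K, v y = inner ℝ G y + β := by
    intro K hK
    obtain ⟨a, ha⟩ := hv K hK
    obtain ⟨G, β, h⟩ := affine_eq_inner a
    exact ⟨G, β, fun y hy => (ha hy).trans (h y)⟩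
  choose! G β h using this
  exact ⟨G, β, h⟩

theorem isCompact_biUnion_simplex {M : Set (Finset (Pt d))} (hM : M.Finite) :
    IsCompact (⋃ K ∈ M, simplex K) :=
  hM.isCompact_biUnion fun K _ => isCompact_simplex K

theorem region_subset (M : Set (Finset (Pt d))) : region M ⊆ ⋃ K ∈ M, simplex K :=
  interior_subset

theorem isOpen_region (M : Set (Finset (Pt d))) : IsOpen (region M) := isOpen_interior

/-- The frontier of a convex set is null. Almost every point of a cell thus has a neighbourhood on
which a piecewise affine function is affine. -/
theorem ae_mem_interior_simplex {M : Set (Finset (Pt d))} (hM : M.Finite) :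
    ∀ᵐ x : Pt d, ∀ K ∈ M, x ∈ simplex K → x ∈ interior (simplex K) := by
  rw [ae_ball_iff hM.countable]
  intro K _
  have h : volume (frontier (simplex K)) = 0 := (convex_simplex K).addHaar_frontier volume
  filter_upwards [measure_eq_zero_iff_ae_notMem.1 h] with x hx hxK
  by_contra hxi
  exact hx ⟨subset_closure hxK, hxi⟩

/-- The product of a test function and a piecewise affine function is Lipschitz. -/
theorem AffineOnCells.exists_lipschitzWith_mul {M : Set (Finset (Pt d))} (hM : M.Finite)
    {v : Pt d → ℝ} (hv : AffineOnCells M v) {φ : Pt d → ℝ} (hφ : ContDiff ℝ ∞ φ)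
    (hφc : HasCompactSupport φ) (hφU : tsupport φ ⊆ region M) :
    ∃ C, LipschitzWith C fun x => φ x * v x := by
  obtain ⟨G, β, hG⟩ := hv.exists_inner
  -- The whole space is covered by the cells, where the product is smooth, and the complement of the
  -- region, where `φ` vanishes.
  refine exists_lipschitzWith_of_finite_closed_cover (𝒮 := insert (region M)ᶜ (simplex '' M))
    ((hM.image _).insert _) ?_ ?_ ?_
  · rintro S (rfl | ⟨K, -, rfl⟩)
    · exact (isOpen_region M).isClosed_compl
    · exact (isCompact_simplex K).isClosed
  · refine eq_univ_of_forall fun x => ?_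
    by_cases hx : x ∈ region M
    · obtain ⟨K, hK, hxK⟩ : ∃ K ∈ M, x ∈ simplex K := by simpa using region_subset M hx
      exact ⟨_, mem_insert_of_mem _ (mem_image_of_mem _ hK), hxK⟩
    · exact ⟨_, mem_insert _ _, hx⟩
  · rintro S (rfl | ⟨K, hK, rfl⟩)
    · refine ⟨0, LipschitzOnWith.of_dist_le_mul fun x hx y hy => ?_⟩
      have h0 : ∀ z ∈ (region M)ᶜ, φ z = 0 := fun z hz =>
        image_eq_zero_of_notMem_tsupport fun h => hz (hφU h)
      simp [h0 x hx, h0 y hy]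
    · have hsm : ContDiff ℝ 1 fun x => φ x * (inner ℝ (G K) x + β K) :=
        (hφ.of_le (by exact_mod_cast le_top)).mul
          ((contDiff_const.inner ℝ contDiff_id).add contDiff_const)
      obtain ⟨C, hC⟩ := hsm.lipschitzWith_of_hasCompactSupport (hφc.mul_right) one_ne_zero
      refine ⟨C, LipschitzOnWith.of_dist_le_mul fun x hx y hy => ?_⟩
      rw [hG K hK x hx, hG K hK y hy]
      exact hC.dist_le_mul x y

theorem hasFDerivAt_inner_add (G : Pt d) (β : ℝ) (x : Pt d) :
    HasFDerivAt (fun y => inner ℝ G y + β) (InnerProductSpace.toDual ℝ (Pt d) G) x := by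
  have := (InnerProductSpace.toDual ℝ (Pt d) G).hasFDerivAt (x := x)
  simpa using this.add_const β

theorem gradient_eq_of_mem_interior {v : Pt d → ℝ} {S : Set (Pt d)} {G : Pt d} {β : ℝ}
    (hv : ∀ y ∈ S, v y = inner ℝ G y + β) {x : Pt d} (hx : x ∈ interior S) :
    HasGradientAt v G x := by
  rw [hasGradientAt_iff_hasFDerivAt]
  refine (hasFDerivAt_inner_add G β x).congr_of_eventuallyEq ?_
  filter_upwards [mem_interior_iff_mem_nhds.1 hx] with y hy using hv y hy

/-- The affine pieces are restrictions of one function to closed cells, so they glue to a continuous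
function on the compact union. -/
theorem AffineOnCells.memLp {M : Set (Finset (Pt d))} (hM : M.Finite) {v : Pt d → ℝ}
    (hv : AffineOnCells M v) : MemLp v 2 (volume.restrict (region M)) := by
  obtain ⟨G, β, hG⟩ := hv.exists_inner
  have hC := isCompact_biUnion_simplex hM
  have hcont : ContinuousOn v (⋃ K ∈ M, simplex K) := by
    have := hM.to_subtype
    rw [biUnion_eq_iUnion]
    refine (locallyFinite_of_finite _).continuousOn_iUnion
      (fun K => (isCompact_simplex _).isClosed) fun K => ?_
    exact ContinuousOn.congr (by fun_prop) fun y hy => hG K K.2 y hy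
  have hmono : volume.restrict (region M) ≤ volume.restrict (⋃ K ∈ M, simplex K) :=
    Measure.restrict_mono (region_subset M) le_rfl
  have : IsFiniteMeasure (volume.restrict (⋃ K ∈ M, simplex K)) :=
    isFiniteMeasure_restrict.2 hC.measure_lt_top.ne
  obtain ⟨B, hB⟩ := hC.exists_bound_of_continuousOn hcont
  refine MemLp.mono_measure hmono (MemLp.of_bound
    (hcont.aestronglyMeasurable hC.isClosed.measurableSet) B ?_)
  exact (ae_restrict_iff' hC.isClosed.measurableSet).2 (.of_forall hB)

theorem isFiniteMeasure_region {M : Set (Finset (Pt d))} (hM : M.Finite) :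
    IsFiniteMeasure (volume.restrict (region M)) :=
  isFiniteMeasure_restrict.2
    ((measure_mono (region_subset M)).trans_lt (isCompact_biUnion_simplex hM).measure_lt_top).ne

theorem measurable_gradient (v : Pt d → ℝ) : Measurable (gradient v) :=
  (InnerProductSpace.toDual ℝ (Pt d)).symm.continuous.measurable.comp (measurable_fderiv ℝ v)

theorem AffineOnCells.memLp_gradient {M : Set (Finset (Pt d))} (hM : M.Finite) {v : Pt d → ℝ}
    (hv : AffineOnCells M v) : MemLp (gradient v) 2 (volume.restrict (region M)) := by
  obtain ⟨G, β, hG⟩ := hv.exists_inner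
  have := isFiniteMeasure_region hM
  obtain ⟨B, hB⟩ := (hM.image fun K => ‖G K‖).bddAbove
  refine MemLp.of_bound (measurable_gradient v).aestronglyMeasurable B ?_
  rw [ae_restrict_iff' (isOpen_region M).measurableSet]
  filter_upwards [ae_mem_interior_simplex hM] with x hx hxU
  obtain ⟨K, hK, hxK⟩ : ∃ K ∈ M, x ∈ simplex K := by simpa using region_subset M hxU
  rw [(gradient_eq_of_mem_interior (hG K hK) (hx K hK hxK)).gradient]
  exact hB (mem_image_of_mem _ hK)

theorem memLp_two_gradient {φ : Pt d → ℝ} (hφ : ContDiff ℝ ∞ φ) (hφc : HasCompactSupport φ)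
    (μ : Measure (Pt d)) [IsFiniteMeasureOnCompacts μ] : MemLp (gradient φ) 2 μ := by
  refine Continuous.memLp_of_hasCompactSupport ?_ ?_
  · exact (InnerProductSpace.toDual ℝ (Pt d)).symm.continuous.comp
      (hφ.continuous_fderiv (by simp))
  · exact (hφc.fderiv ℝ).comp_left (map_zero _)

theorem integrable_smul_of_memLp_two {μ : Measure (Pt d)} {f : Pt d → ℝ} {g : Pt d → Pt d}
    (hf : MemLp f 2 μ) (hg : MemLp g 2 μ) : Integrable (fun x => f x • g x) μ :=
  memLp_one_iff_integrable.1 (hg.smul hf)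

/-- Since `φ * v` is Lipschitz with compact support, its directional derivatives integrate to zero;
the product rule holds almost everywhere, at interior points of cells. No jump terms appear. -/
theorem AffineOnCells.isWeakGrad {M : Set (Finset (Pt d))} (hM : M.Finite) {v : Pt d → ℝ}
    (hv : AffineOnCells M v) : IsWeakGrad (region M) v (gradient v) := by
  intro φ hφ hφc hφU
  obtain ⟨G, β, hG⟩ := hv.exists_inner
  have i1 : Integrable (fun x => v x • gradient φ x) (volume.restrict (region M)) :=
    integrable_smul_of_memLp_two (hv.memLp hM) (memLp_two_gradient hφ hφc _)
  have i2 : Integrable (fun x => φ x • gradient v x) (volume.restrict (region M)) :=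
    integrable_smul_of_memLp_two (hφ.continuous.memLp_of_hasCompactSupport hφc)
      (hv.memLp_gradient hM)
  rw [← add_eq_zero_iff_eq_neg, ← integral_add i1 i2]
  refine ext_inner_left ℝ fun e => ?_
  have hin := integral_inner (𝕜 := ℝ) (i1.add i2) e
  simp only [Pi.add_apply] at hin
  rw [← hin, inner_zero_right]
  obtain ⟨C, hC⟩ := hv.exists_lipschitzWith_mul hM hφ hφc hφU
  -- Integration by parts against the constant `1`. The formula reverses the direction on the second
  -- factor, so `-e` produces the derivative of `φ * v` along `e`.
  have key := (LipschitzWith.const (1 : ℝ)).integral_lineDeriv_mul_eq (μ := (volume : Measure (Pt d)))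
    hC (hφc.mul_right) (-e)
  simp only [neg_neg, mul_one] at key
  have h0 : ∀ x, lineDeriv ℝ (fun _ : Pt d => (1 : ℝ)) x (-e) = 0 := fun x => by
    simp [lineDeriv]
  simp only [h0, zero_mul, integral_zero] at key
  rw [key, ← integral_indicator (isOpen_region M).measurableSet]
  refine integral_congr_ae ?_
  filter_upwards [ae_mem_interior_simplex hM] with x hx
  by_cases hxφ : x ∈ tsupport φ
  · have hxU := hφU hxφ
    obtain ⟨K, hK, hxK⟩ : ∃ K ∈ M, x ∈ simplex K := by simpa using region_subset M hxU
    have hgv := gradient_eq_of_mem_interior (hG K hK) (hx K hK hxK)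
    have hgφ : HasFDerivAt φ (fderiv ℝ φ x) x :=
      (hφ.differentiable (by simp) x).hasFDerivAt
    have hd := (hgφ.mul hgv.hasFDerivAt).hasLineDerivAt e
    rw [indicator_of_mem hxU, hgv.gradient]
    have e1 : inner ℝ e (gradient φ x) = fderiv ℝ φ x e := by
      rw [real_inner_comm, gradient, InnerProductSpace.toDual_symm_apply]
    have := hd.lineDeriv
    rw [show (fun x => φ x * v x) = φ * v from rfl, this]
    simp [inner_add_right, inner_smul_right, e1, real_inner_comm]
    ring
  · have hz : φ =ᶠ[nhds x] 0 := notMem_tsupport_iff_eventuallyEq.1 hxφ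
    have hz' : (fun x => φ x * v x) =ᶠ[nhds x] fun _ => 0 := by
      filter_upwards [hz] with y hy
      simp [hy]
    have hl : lineDeriv ℝ (fun x => φ x * v x) x e = 0 := by
      rw [hz'.lineDeriv_eq]
      simp [lineDeriv]
    have hgφ : gradient φ x = 0 := by
      rw [gradient, hz.fderiv_eq]
      simp
    rw [hl]
    simp [indicator, hz.self_of_nhds, hgφ]

theorem AffineOnCells.memH1 {M : Set (Finset (Pt d))} (hM : M.Finite) {v : Pt d → ℝ}
    (hv : AffineOnCells M v) : MemH1 (region M) v :=
  ⟨hv.memLp hM, _, hv.memLp_gradient hM, hv.isWeakGrad hM⟩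

theorem MemH1.memLp_weakGrad {U : Set (Pt d)} {u : Pt d → ℝ} (hu : MemH1 U u) :
    MemLp (weakGrad U u) 2 (volume.restrict U) := by
  rw [weakGrad, dif_pos hu]
  exact hu.2.choose_spec.1

theorem MemH1.isWeakGrad_weakGrad {U : Set (Pt d)} {u : Pt d → ℝ} (hu : MemH1 U u) :
    IsWeakGrad U u (weakGrad U u) := by
  rw [weakGrad, dif_pos hu]
  exact hu.2.choose_spec.2

/-- Square integrable weak gradients on an open set are unique. -/
theorem IsWeakGrad.ae_eq {U : Set (Pt d)} (hU : IsOpen U) {u : Pt d → ℝ} {g g' : Pt d → Pt d}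
    (hg : MemLp g 2 (volume.restrict U)) (hg' : MemLp g' 2 (volume.restrict U))
    (h : IsWeakGrad U u g) (h' : IsWeakGrad U u g') : ∀ᵐ x, x ∈ U → g x = g' x := by
  have hloc : LocallyIntegrableOn (g - g') U :=
    locallyIntegrableOn_of_locallyIntegrable_restrict
      ((hg.sub hg').locallyIntegrable one_le_two)
  have := hU.ae_eq_zero_of_integral_contDiff_smul_eq_zero hloc ?_
  · filter_upwards [this] with x hx hxU using sub_eq_zero.1 (hx hxU)
  intro φ hφ hφc hφU
  have hφL : MemLp φ 2 (volume.restrict U) := hφ.continuous.memLp_of_hasCompactSupport hφc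
  have i1 : Integrable (fun x => φ x • g x) (volume.restrict U) :=
    integrable_smul_of_memLp_two hφL hg
  have i2 : Integrable (fun x => φ x • g' x) (volume.restrict U) :=
    integrable_smul_of_memLp_two hφL hg'
  rw [← setIntegral_eq_integral_of_forall_compl_eq_zero (s := U)]
  · simp only [Pi.sub_apply, smul_sub]
    rw [integral_sub i1 i2, sub_eq_zero, ← neg_inj, ← h φ hφ hφc hφU, h' φ hφ hφc hφU]
  · intro x hx
    rw [image_eq_zero_of_notMem_tsupport fun hh => hx (hφU hh), zero_smul]

/-- A closed cell may touch the boundary of the open region, so inclusion holds only up to a null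
set; this suffices to restrict integrals. -/
theorem ae_mem_region {M : Set (Finset (Pt d))} (hM : M.Finite) {K : Finset (Pt d)}
    (hK : K ∈ M) : ∀ᵐ x : Pt d, x ∈ simplex K → x ∈ region M := by
  filter_upwards [ae_mem_interior_simplex hM] with x hx hxK
  exact interior_mono (subset_biUnion_of_mem (u := simplex) hK) (hx K hK hxK)

theorem restrict_simplex_le {M : Set (Finset (Pt d))} (hM : M.Finite) {K : Finset (Pt d)}
    (hK : K ∈ M) : volume.restrict (simplex K) ≤ volume.restrict (region M) :=
  Measure.restrict_mono_ae (ae_mem_region hM hK)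

/-- A piecewise affine function has, on every cell, the classical gradient as weak gradient. -/
theorem AffineOnCells.exists_grad_eq {M : Set (Finset (Pt d))} (hM : M.Finite) {v : Pt d → ℝ}
    (hv : AffineOnCells M v) {K : Finset (Pt d)} (hK : K ∈ M) :
    ∃ (G : Pt d) (β : ℝ), (∀ y ∈ simplex K, v y = inner ℝ G y + β) ∧
      ∀ᵐ x ∂volume.restrict (simplex K), grad M v x = G := by
  obtain ⟨G, β, hG⟩ := hv.exists_inner
  refine ⟨G K, β K, hG K hK, ?_⟩
  have hH := hv.memH1 hM
  rw [ae_restrict_iff' (isCompact_simplex K).isClosed.measurableSet]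
  filter_upwards [ae_mem_interior_simplex hM, ae_mem_region hM hK,
    hH.isWeakGrad_weakGrad.ae_eq (isOpen_region M) hH.memLp_weakGrad (hv.memLp_gradient hM)
      (hv.isWeakGrad hM)] with x hx hxU hxg hxK
  rw [grad, hxg (hxU hxK)]
  exact (gradient_eq_of_mem_interior (hG K hK) (hx K hK hxK)).gradient

/-! ### Diameters and volumes -/

/-- The edges of a cell are at least as long as the diameter of any inscribed ball. -/
theorem two_mul_le_dist {K : Finset (Pt d)} (hind : AffineIndependent ℝ ((↑) : K → Pt d))
    (hcard : K.card = d + 1) {c : Pt d} {r : ℝ} (hr : 0 ≤ r)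
    (hball : Metric.closedBall c r ⊆ simplex K) {v w : Pt d} (hv : v ∈ K) (hw : w ∈ K)
    (hvw : v ≠ w) : 2 * r ≤ dist v w := by
  obtain ⟨lam, h1, h0, hout⟩ := exists_barycentric hind hcard
  have hrange : ∀ y ∈ simplex K, 0 ≤ lam v y ∧ lam v y ≤ 1 := by
    intro y hy
    obtain ⟨b, hb⟩ := exists_isBary hy
    rw [← hb.eq_coord h1 h0 hout]
    refine ⟨hb.1 v hv, ?_⟩
    rw [← hb.2.2.1]
    exact Finset.single_le_sum (fun i hi => hb.1 i hi) hv
  have hpos : 0 < dist v w := dist_pos.2 hvw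
  -- `c ± z` are the ends of the diameter of the ball parallel to the edge. Between them the
  -- coordinate at `v` changes by `2 * r / dist v w`, which is at most `1` because the coordinate
  -- stays in `[0, 1]`.
  set z : Pt d := (r / dist v w) • (v - w) with hz
  have hznorm : ‖z‖ = r := by
    rw [hz, norm_smul, Real.norm_of_nonneg (by positivity), ← dist_eq_norm,
      div_mul_cancel₀ _ hpos.ne']
  have hp := hrange (c + z) (hball (by simp [hznorm]))
  have hm := hrange (c - z) (hball (by simp [hznorm]))
  have hdiff : lam v (c + z) - lam v (c - z) = 2 * (r / dist v w) := by
    have e1 : lam v v - lam v w = (lam v).linear (v - w) := by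
      simpa using ((lam v).linearMap_vsub v w).symm
    have e2 : lam v (c + z) - lam v (c - z) = (lam v).linear (z + z) := by
      have := ((lam v).linearMap_vsub (c + z) (c - z)).symm
      simpa using this
    rw [e2, map_add, hz, map_smul, ← e1, h1 v hv, h0 v hv w hw hvw, smul_eq_mul]
    ring
  have : 2 * (r / dist v w) ≤ 1 := by linarith [hp.2, hm.1]
  rw [← mul_div_assoc, div_le_one hpos] at this
  exact this

theorem measureReal_le_of_diam_le {S : Set (Pt d)} (hS : Bornology.IsBounded S) {c : Pt d}
    {r t : ℝ} (hr : 0 ≤ r) (ht : 0 ≤ t) (hd : Metric.diam S ≤ t * r) :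
    volume.real S ≤ t ^ d * volume.real (Metric.closedBall c r) := by
  rcases S.eq_empty_or_nonempty with rfl | ⟨x, hx⟩
  · simp only [measureReal_empty]
    positivity
  have hsub : S ⊆ Metric.closedBall x (t * r) := fun y hy =>
    (Metric.dist_le_diam_of_mem hS hy hx).trans hd
  refine (measureReal_mono hsub Metric.isBounded_closedBall.measure_lt_top.ne).trans_eq ?_
  rw [Measure.addHaar_real_closedBall _ _ (by positivity),
    Measure.addHaar_real_closedBall _ _ hr, finrank_euclideanSpace_fin]
  ring

theorem measureReal_closedBall_pos (c : Pt d) {r : ℝ} (hr : 0 < r) :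
    0 < volume.real (Metric.closedBall c r) :=
  ENNReal.toReal_pos (Metric.measure_closedBall_pos volume c hr).ne'
    Metric.isBounded_closedBall.measure_lt_top.ne

/-! ### Transfer and inverse estimates for affine functions -/

theorem abs_inner_add_sub_le {v : Pt d → ℝ} {S : Set (Pt d)} {G : Pt d} {β : ℝ}
    (hv : ∀ y ∈ S, v y = inner ℝ G y + β) (hS : Bornology.IsBounded S) {x y : Pt d} (hx : x ∈ S)
    (hy : y ∈ S) : |v y - v x| ≤ ‖G‖ * Metric.diam S := by
  have : v y - v x = inner ℝ G (y - x) := by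
    rw [hv x hx, hv y hy, inner_sub_right]
    ring
  rw [this]
  refine (abs_real_inner_le_norm _ _).trans ?_
  gcongr
  rw [← dist_eq_norm]
  exact Metric.dist_le_diam_of_mem hS hy hx

theorem continuousOn_of_eq_inner {v : Pt d → ℝ} {S : Set (Pt d)} {G : Pt d} {β : ℝ}
    (hv : ∀ y ∈ S, v y = inner ℝ G y + β) : ContinuousOn v S :=
  ContinuousOn.congr (by fun_prop) hv

theorem integrableOn_sq_of_eq_inner {v : Pt d → ℝ} {S : Set (Pt d)} (hS : IsCompact S) {G : Pt d}
    {β : ℝ} (hv : ∀ y ∈ S, v y = inner ℝ G y + β) : IntegrableOn (fun x => v x ^ 2) S :=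
  ((continuousOn_of_eq_inner hv).pow 2).integrableOn_compact hS

/-- Transfer of `L²` norms between two sets with a common point for a function that is affine on
each of them. -/
theorem integral_sq_le_of_eq_inner {v : Pt d → ℝ} {S₁ S₂ : Set (Pt d)} (hS₁ : IsCompact S₁)
    (hS₂ : IsCompact S₂) {G₁ G₂ : Pt d} {β₁ β₂ : ℝ} (hv₁ : ∀ y ∈ S₁, v y = inner ℝ G₁ y + β₁)
    (hv₂ : ∀ y ∈ S₂, v y = inner ℝ G₂ y + β₂) (hne : (S₁ ∩ S₂).Nonempty) {τ : ℝ}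
    (hpos : 0 < volume.real S₁) (hτ : volume.real S₂ ≤ τ * volume.real S₁) :
    ∫ x in S₂, v x ^ 2 ≤ 3 * (τ * ∫ x in S₁, v x ^ 2) +
      3 * (volume.real S₂ * (Metric.diam S₁ ^ 2 * ‖G₁‖ ^ 2 + Metric.diam S₂ ^ 2 * ‖G₂‖ ^ 2)) := by
  obtain ⟨a, ha₁, ha₂⟩ := hne
  set E : ℝ := Metric.diam S₁ ^ 2 * ‖G₁‖ ^ 2 + Metric.diam S₂ ^ 2 * ‖G₂‖ ^ 2
  have hpt : ∀ x ∈ S₁, ∀ y ∈ S₂, v y ^ 2 ≤ 3 * v x ^ 2 + 3 * E := by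
    intro x hx y hy
    have e1 := abs_inner_add_sub_le hv₁ hS₁.isBounded hx ha₁
    have e2 := abs_inner_add_sub_le hv₂ hS₂.isBounded ha₂ hy
    have q1 : (v a - v x) ^ 2 ≤ Metric.diam S₁ ^ 2 * ‖G₁‖ ^ 2 := by
      rw [← sq_abs]
      exact (pow_le_pow_left₀ (abs_nonneg _) e1 2).trans_eq (by ring)
    have q2 : (v y - v a) ^ 2 ≤ Metric.diam S₂ ^ 2 * ‖G₂‖ ^ 2 := by
      rw [← sq_abs]
      exact (pow_le_pow_left₀ (abs_nonneg _) e2 2).trans_eq (by ring)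
    have : v y ^ 2 ≤ 3 * (v x ^ 2 + (v a - v x) ^ 2 + (v y - v a) ^ 2) := by
      nlinarith [sq_nonneg (v x - (v a - v x)), sq_nonneg (v x - (v y - v a)),
        sq_nonneg ((v a - v x) - (v y - v a))]
    linarith
  have i1 := integrableOn_sq_of_eq_inner hS₁ hv₁
  have i2 := integrableOn_sq_of_eq_inner hS₂ hv₂
  have hconst : ∀ {S : Set (Pt d)}, IsCompact S → ∀ b : ℝ, IntegrableOn (fun _ => b) S :=
    fun hS b => integrableOn_const hS.measure_lt_top.ne
  -- The pointwise bound is averaged over `x ∈ S₁` with `y` fixed, and afterwards integrated over `y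
  -- ∈ S₂`.
  have hy : ∀ y ∈ S₂, v y ^ 2 ≤ 3 * ((volume.real S₁)⁻¹ * ∫ x in S₁, v x ^ 2) + 3 * E := by
    intro y hy
    have := setIntegral_mono_on (hconst hS₁ (v y ^ 2)) ((i1.const_mul 3).add (hconst hS₁ (3 * E)))
      hS₁.isClosed.measurableSet fun x hx => hpt x hx y hy
    simp only [Pi.add_apply] at this
    rw [integral_add (i1.const_mul 3) (hconst hS₁ (3 * E)), integral_const_mul, setIntegral_const,
      setIntegral_const, smul_eq_mul, smul_eq_mul] at this
    refine le_of_mul_le_mul_left (this.trans_eq ?_) hpos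
    field_simp
  have := setIntegral_mono_on i2 (hconst hS₂ _) hS₂.isClosed.measurableSet hy
  rw [setIntegral_const, smul_eq_mul] at this
  have hI : 0 ≤ (volume.real S₁)⁻¹ * ∫ x in S₁, v x ^ 2 := by positivity
  have h3 := mul_le_mul_of_nonneg_right hτ hI
  rw [mul_assoc, mul_inv_cancel_left₀ hpos.ne'] at h3
  linarith

/-- Inverse inequality for affine functions. -/
theorem diam_sq_mul_le_integral_sq {v : Pt d → ℝ} {S : Set (Pt d)} (hS : IsCompact S) {G : Pt d}
    {β : ℝ} (hv : ∀ y ∈ S, v y = inner ℝ G y + β) {c : Pt d} {r t : ℝ} (hr : 0 < r) (ht : 0 ≤ t)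
    (hball : Metric.closedBall c r ⊆ S) (hd : Metric.diam S ≤ t * r) :
    Metric.diam S ^ 2 * (volume.real S * ‖G‖ ^ 2) ≤
      16 * t ^ 2 * (4 * t) ^ d * ∫ x in S, v x ^ 2 := by
  have hI : 0 ≤ ∫ x in S, v x ^ 2 := by positivity
  rcases eq_or_ne G 0 with rfl | hG
  · simp only [norm_zero]
    rw [show Metric.diam S ^ 2 * (volume.real S * 0 ^ 2) = 0 by ring]
    positivity
  have hGpos : 0 < ‖G‖ := norm_pos_iff.2 hG
  obtain ⟨e, he, hec⟩ : ∃ e : ℝ, |e| = 1 ∧ 0 ≤ e * v c := by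
    rcases le_total 0 (v c) with h | h
    · exact ⟨1, by simp, by linarith⟩
    · exact ⟨-1, by simp, by linarith⟩
  have hee : e * e = 1 := by rw [← abs_mul_abs_self, he, one_mul]
  -- Moving `r / 2` from `c` along `±G`, with the sign of `v c`, gives `|v| ≥ ‖G‖ * r / 2` at `p`.
  -- On the ball of radius `r / 4` about `p` at most half of this is lost.
  set p : Pt d := c + (e * (r / 2) / ‖G‖) • G with hp
  have hpc : ‖(e * (r / 2) / ‖G‖) • G‖ = r / 2 := by
    rw [norm_smul, norm_div, norm_norm, div_mul_cancel₀ _ hGpos.ne', Real.norm_eq_abs, abs_mul, he,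
      one_mul, abs_of_pos (by positivity)]
  have hsub : Metric.closedBall p (r / 4) ⊆ Metric.closedBall c r := by
    refine Metric.closedBall_subset_closedBall' ?_
    rw [hp, dist_eq_norm, add_sub_cancel_left, hpc]
    linarith
  have hc : c ∈ S := hball (Metric.mem_closedBall_self hr.le)
  have hlow : ∀ y ∈ Metric.closedBall p (r / 4), (‖G‖ * r / 4) ^ 2 ≤ v y ^ 2 := by
    intro y hy
    have hyS := hball (hsub hy)
    have e1 : v y = v c + e * (r / 2) * ‖G‖ + inner ℝ G (y - p) := by
      rw [hv y hyS, hv c hc, hp, ← sub_sub, inner_sub_right, inner_sub_right, inner_smul_right,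
        real_inner_self_eq_norm_sq]
      field_simp
      ring
    have e2 : |e * inner ℝ G (y - p)| ≤ ‖G‖ * (r / 4) := by
      rw [abs_mul, he, one_mul]
      refine (abs_real_inner_le_norm _ _).trans ?_
      gcongr
      simpa [dist_eq_norm] using hy
    have e3 : e * v y = e * v c + r / 2 * ‖G‖ + e * inner ℝ G (y - p) := by
      rw [e1]
      linear_combination (r / 2 * ‖G‖) * hee
    have e4 : ‖G‖ * r / 4 ≤ e * v y := by
      rw [e3]
      linarith [(abs_le.1 e2).1]
    calc (‖G‖ * r / 4) ^ 2 ≤ (e * v y) ^ 2 := pow_le_pow_left₀ (by positivity) e4 2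
      _ = v y ^ 2 := by linear_combination (v y ^ 2) * hee
  have i1 := integrableOn_sq_of_eq_inner hS hv
  have hB : volume.real (Metric.closedBall p (r / 4)) * (‖G‖ * r / 4) ^ 2 ≤ ∫ x in S, v x ^ 2 := by
    rw [← smul_eq_mul, ← setIntegral_const]
    refine (setIntegral_mono_on (integrableOn_const Metric.isBounded_closedBall.measure_lt_top.ne)
      (i1.mono_set (hsub.trans hball)) Metric.isClosed_closedBall.measurableSet hlow).trans ?_
    exact setIntegral_mono_set i1 (.of_forall fun x => sq_nonneg _)
      (LE.le.eventuallyLE (hsub.trans hball))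
  have hvol := measureReal_le_of_diam_le hS.isBounded (c := p) (r := r / 4) (t := 4 * t)
    (by positivity) (by positivity) (hd.trans_eq (by ring))
  calc Metric.diam S ^ 2 * (volume.real S * ‖G‖ ^ 2)
      ≤ (t * r) ^ 2 * (((4 * t) ^ d * volume.real (Metric.closedBall p (r / 4))) * ‖G‖ ^ 2) := by
        gcongr
    _ = 16 * t ^ 2 * (4 * t) ^ d *
        (volume.real (Metric.closedBall p (r / 4)) * (‖G‖ * r / 4) ^ 2) := by ring
    _ ≤ _ := by gcongr

/-! ### Estimates between comparable cells -/

theorem AffineOnCells.integral_grad_eq {M : Set (Finset (Pt d))} (hM : M.Finite) {v : Pt d → ℝ}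
    (hv : AffineOnCells M v) {K : Finset (Pt d)} (hK : K ∈ M) :
    ∃ (G : Pt d) (β : ℝ), (∀ y ∈ simplex K, v y = inner ℝ G y + β) ∧
      ∫ x in simplex K, ‖grad M v x‖ ^ 2 = volume.real (simplex K) * ‖G‖ ^ 2 := by
  obtain ⟨G, β, h, hG⟩ := hv.exists_grad_eq hM hK
  refine ⟨G, β, h, ?_⟩
  rw [← smul_eq_mul, ← setIntegral_const]
  exact integral_congr_ae (hG.mono fun x hx => by simp only [hx])

/-- Two cells with a common vertex, the first of which contains a ball of radius `r` and has
diameter at most `s * (2 * r)`, while the second has at most `s` times the diameter of the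
first. -/
structure ComparableCells (s : ℝ) (K₁ K₂ : Finset (Pt d)) : Prop where
  one_le : 1 ≤ s
  meet : (simplex K₁ ∩ simplex K₂).Nonempty
  ball : ∃ (c : Pt d) (r : ℝ), 0 < r ∧
    Metric.closedBall c r ⊆ simplex K₁ ∧ cellDiam K₁ ≤ s * (2 * r)
  diam_le : cellDiam K₂ ≤ s * cellDiam K₁

/-- `K₂` has diameter at most `2 * s ^ 2 * r`, so its volume is compared with that of the ball of
radius `r` inside `K₁`. -/
theorem ComparableCells.measureReal_le {s : ℝ} {K₁ K₂ : Finset (Pt d)}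
    (h : ComparableCells s K₁ K₂) : 0 < volume.real (simplex K₁) ∧
      volume.real (simplex K₂) ≤ (2 * s ^ 2) ^ d * volume.real (simplex K₁) := by
  obtain ⟨c, r, hr, hball, hd⟩ := h.ball
  have hs := zero_le_one.trans h.one_le
  have hmono : volume.real (Metric.closedBall c r) ≤ volume.real (simplex K₁) :=
    measureReal_mono hball (isCompact_simplex K₁).measure_lt_top.ne
  refine ⟨(measureReal_closedBall_pos c hr).trans_le hmono, ?_⟩
  refine (measureReal_le_of_diam_le (isCompact_simplex K₂).isBounded (c := c) hr.le
    (t := 2 * s ^ 2) (by positivity) ?_).trans (by gcongr)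
  calc Metric.diam (simplex K₂) ≤ s * cellDiam K₁ := h.diam_le
    _ ≤ s * (s * (2 * r)) := by gcongr
    _ = 2 * s ^ 2 * r := by ring

theorem AffineOnCells.integral_sq_le {M : Set (Finset (Pt d))} (hM : M.Finite) {v : Pt d → ℝ}
    (hv : AffineOnCells M v) {s : ℝ} {K₁ K₂ : Finset (Pt d)} (h : ComparableCells s K₁ K₂)
    (hK₁ : K₁ ∈ M) (hK₂ : K₂ ∈ M) :
    ∫ x in simplex K₂, v x ^ 2 ≤ 3 * ((2 * s ^ 2) ^ d * ∫ x in simplex K₁, v x ^ 2) +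
      3 * ((2 * s ^ 2) ^ d * (cellDiam K₁ ^ 2 * ∫ x in simplex K₁, ‖grad M v x‖ ^ 2) +
        cellDiam K₂ ^ 2 * ∫ x in simplex K₂, ‖grad M v x‖ ^ 2) := by
  obtain ⟨G₁, β₁, h₁, e₁⟩ := hv.integral_grad_eq hM hK₁
  obtain ⟨G₂, β₂, h₂, e₂⟩ := hv.integral_grad_eq hM hK₂
  obtain ⟨hpos, hτ⟩ := h.measureReal_le
  have key := integral_sq_le_of_eq_inner (isCompact_simplex K₁) (isCompact_simplex K₂) h₁ h₂ h.meet
    hpos hτ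
  rw [e₁, e₂]
  refine key.trans ?_
  have := mul_le_mul_of_nonneg_right hτ
    (by positivity : 0 ≤ Metric.diam (simplex K₁) ^ 2 * ‖G₁‖ ^ 2)
  simp only [cellDiam]
  linarith

theorem AffineOnCells.inverse_inequality {M : Set (Finset (Pt d))} (hM : M.Finite)
    {v : Pt d → ℝ} (hv : AffineOnCells M v) {s : ℝ} {K₁ K₂ : Finset (Pt d)}
    (h : ComparableCells s K₁ K₂) (hK₁ : K₁ ∈ M) :
    cellDiam K₁ ^ 2 * ∫ x in simplex K₁, ‖grad M v x‖ ^ 2 ≤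
      16 * (2 * s) ^ 2 * (4 * (2 * s)) ^ d * ∫ x in simplex K₁, v x ^ 2 := by
  obtain ⟨G, β, h₁, e⟩ := hv.integral_grad_eq hM hK₁
  obtain ⟨c, r, hr, hball, hd⟩ := h.ball
  have hs := zero_le_one.trans h.one_le
  rw [e]
  exact diam_sq_mul_le_integral_sq (isCompact_simplex K₁) h₁ hr (by positivity) hball
    (hd.trans_eq (by ring))

/-! ### Control by the stabilization form -/

theorem integrableOn_sq_norm {E : Type*} [NormedAddCommGroup E] {M : Set (Finset (Pt d))}
    (hM : M.Finite) {g : Pt d → E} (hg : MemLp g 2 (volume.restrict (region M)))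
    {K : Finset (Pt d)} (hK : K ∈ M) : IntegrableOn (fun x => ‖g x‖ ^ 2) (simplex K) := by
  have h := hg.mono_measure (restrict_simplex_le hM hK)
  exact (memLp_two_iff_integrable_sq_norm h.1).1 h

theorem setIntegral_le_union {S₁ S₂ : Set (Pt d)} {f : Pt d → ℝ} (hf : ∀ x, 0 ≤ f x)
    (h₁ : IntegrableOn f S₁) (h₂ : IntegrableOn f S₂) :
    ∫ x in S₁, f x ≤ ∫ x in S₁ ∪ S₂, f x ∧ ∫ x in S₂, f x ≤ ∫ x in S₁ ∪ S₂, f x :=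
  ⟨setIntegral_mono_set (h₁.union h₂) (.of_forall hf)
      (LE.le.eventuallyLE subset_union_left),
    setIntegral_mono_set (h₁.union h₂) (.of_forall hf)
      (LE.le.eventuallyLE subset_union_right)⟩

theorem setIntegral_norm_sq_le_add {M : Set (Finset (Pt d))} (hM : M.Finite) {f g : Pt d → Pt d}
    (hf : MemLp f 2 (volume.restrict (region M))) (hg : MemLp g 2 (volume.restrict (region M)))
    {K : Finset (Pt d)} (hK : K ∈ M) : ∫ x in simplex K, ‖f x‖ ^ 2 ≤
      2 * (∫ x in simplex K, ‖g x‖ ^ 2) + 2 * ∫ x in simplex K, ‖f x - g x‖ ^ 2 := by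
  have i1 := (integrableOn_sq_norm hM hg hK).const_mul 2
  have i2 : IntegrableOn (fun x => 2 * ‖f x - g x‖ ^ 2) (simplex K) :=
    (integrableOn_sq_norm hM (hf.sub hg) hK).const_mul 2
  rw [← integral_const_mul, ← integral_const_mul, ← integral_add i1 i2]
  refine integral_mono (integrableOn_sq_norm hM hf hK) (i1.add i2) fun x => ?_
  have h1 : ‖f x‖ ≤ ‖g x‖ + ‖f x - g x‖ := by
    simpa using norm_add_le (g x) (f x - g x)
  have h2 := pow_le_pow_left₀ (norm_nonneg _) h1 2
  simp only
  nlinarith [sq_nonneg (‖g x‖ - ‖f x - g x‖)]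

/-- Transfer of the `L²` norm of a vector field that is piecewise affine. -/
theorem integral_norm_sq_le {M : Set (Finset (Pt d))} (hM : M.Finite) {p : Pt d → Pt d}
    (hp : ∀ i, AffineOnCells M fun y => p y i) {s : ℝ} {K₁ K₂ : Finset (Pt d)}
    (h : ComparableCells s K₁ K₂) (hK₁ : K₁ ∈ M) (hK₂ : K₂ ∈ M) :
    ∫ x in simplex K₂, ‖p x‖ ^ 2 ≤ 3 * ((2 * s ^ 2) ^ d * ∫ x in simplex K₁, ‖p x‖ ^ 2) +
      3 * ((2 * s ^ 2) ^ d *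
          (cellDiam K₁ ^ 2 * ∫ x in simplex K₁, ∑ i, ‖grad M (fun y => p y i) x‖ ^ 2) +
        cellDiam K₂ ^ 2 * ∫ x in simplex K₂, ∑ i, ‖grad M (fun y => p y i) x‖ ^ 2) := by
  have hi : ∀ K ∈ M, ∀ i, IntegrableOn (fun x => p x i ^ 2) (simplex K) := fun K hK i => by
    simpa using integrableOn_sq_norm hM ((hp i).memLp hM) hK
  have hg : ∀ K ∈ M, ∀ i, IntegrableOn (fun x => ‖grad M (fun y => p y i) x‖ ^ 2) (simplex K) :=
    fun K hK i => integrableOn_sq_norm hM ((hp i).memH1 hM).memLp_weakGrad hK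
  simp only [EuclideanSpace.real_norm_sq_eq (p _)]
  rw [integral_finsetSum _ fun i _ => hi K₁ hK₁ i, integral_finsetSum _ fun i _ => hi K₂ hK₂ i,
    integral_finsetSum _ fun i _ => hg K₁ hK₁ i, integral_finsetSum _ fun i _ => hg K₂ hK₂ i]
  refine (Finset.sum_le_sum fun i _ => (hp i).integral_sq_le hM h hK₁ hK₂).trans_eq ?_
  simp only [Finset.sum_add_distrib, Finset.mul_sum, mul_add]

theorem localStab_self (Ω : Set (Pt d)) (M : Set (Finset (Pt d))) (K K' : Finset (Pt d))
    (u : Pt d → ℝ) : localStab Ω M K K' u u =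
      (∫ x in simplex K ∪ simplex K', ‖grad M u x - projGrad Ω M u x‖ ^ 2) +
        max (cellDiam K) (cellDiam K') ^ 2 * ∫ x in simplex K ∪ simplex K',
          ∑ i : Fin d, ‖grad M (fun y => projGrad Ω M u y i) x‖ ^ 2 := by
  simp only [localStab, real_inner_self_eq_norm_sq]

/-- Transfer of the gradient norm between neighbouring cells by the stabilization form. -/
theorem MemH1.integral_grad_sq_le {T : Geometry.SimplicialComplex ℝ (Pt d)}
    {M : Set (Finset (Pt d))} (hMT : M ⊆ cells T) (hM : M.Finite) (Ω : Set (Pt d))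
    {u : Pt d → ℝ} (hu : MemH1 (region M) u) {s : ℝ} {K₁ K₂ : Finset (Pt d)}
    (h : ComparableCells s K₁ K₂) (hK₁ : K₁ ∈ M) (hK₂ : K₂ ∈ M) :
    ∫ x in simplex K₂, ‖grad M u x‖ ^ 2 ≤ 14 * (2 * s ^ 2) ^ d *
      ((∫ x in simplex K₁, ‖grad M u x‖ ^ 2) + localStab Ω M K₁ K₂ u u) := by
  rw [localStab_self]
  have hp : ∀ i, AffineOnCells M fun y => projGrad Ω M u y i :=
    affineOnCells_lumpedProj hMT hM Ω _
  set p := projGrad Ω M u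
  have hgL : MemLp (grad M u) 2 (volume.restrict (region M)) := hu.memLp_weakGrad
  have hpL : MemLp p 2 (volume.restrict (region M)) :=
    MemLp.of_eval_piLp fun i => (hp i).memLp hM
  have a₂ := setIntegral_norm_sq_le_add hM hgL hpL hK₂
  have a₁ := setIntegral_norm_sq_le_add hM hpL hgL hK₁
  simp only [norm_sub_rev (p _)] at a₁
  have key := integral_norm_sq_le hM hp h hK₁ hK₂
  obtain ⟨b₁, b₂⟩ := setIntegral_le_union (f := fun x => ‖grad M u x - p x‖ ^ 2)
    (fun x => sq_nonneg _) (integrableOn_sq_norm hM (hgL.sub hpL) hK₁)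
    (integrableOn_sq_norm hM (hgL.sub hpL) hK₂)
  have hD : ∀ K ∈ M, IntegrableOn (fun x => ∑ i, ‖grad M (fun y => p y i) x‖ ^ 2) (simplex K) :=
    fun K hK => integrable_finsetSum _ fun i _ =>
      integrableOn_sq_norm hM ((hp i).memH1 hM).memLp_weakGrad hK
  obtain ⟨c₁, c₂⟩ := setIntegral_le_union (fun x => Finset.sum_nonneg fun i _ => sq_nonneg _)
    (hD K₁ hK₁) (hD K₂ hK₂)
  have hτ : 1 ≤ (2 * s ^ 2) ^ d := by
    refine one_le_pow₀ ?_
    nlinarith [h.one_le]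
  have d₁ : cellDiam K₁ ^ 2 * ∫ x in simplex K₁, ∑ i, ‖grad M (fun y => p y i) x‖ ^ 2 ≤
      max (cellDiam K₁) (cellDiam K₂) ^ 2 *
        ∫ x in simplex K₁ ∪ simplex K₂, ∑ i, ‖grad M (fun y => p y i) x‖ ^ 2 :=
    mul_le_mul (pow_le_pow_left₀ Metric.diam_nonneg (le_max_left _ _) 2) c₁ (by positivity)
      (by positivity)
  have d₂ : cellDiam K₂ ^ 2 * ∫ x in simplex K₂, ∑ i, ‖grad M (fun y => p y i) x‖ ^ 2 ≤
      max (cellDiam K₁) (cellDiam K₂) ^ 2 *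
        ∫ x in simplex K₁ ∪ simplex K₂, ∑ i, ‖grad M (fun y => p y i) x‖ ^ 2 :=
    mul_le_mul (pow_le_pow_left₀ Metric.diam_nonneg (le_max_right _ _) 2) c₂ (by positivity)
      (by positivity)
  have hD0 : 0 ≤ max (cellDiam K₁) (cellDiam K₂) ^ 2 *
      ∫ x in simplex K₁ ∪ simplex K₂, ∑ i, ‖grad M (fun y => p y i) x‖ ^ 2 := by positivity
  have hS0 : 0 ≤ ∫ x in simplex K₁ ∪ simplex K₂, ‖grad M u x - p x‖ ^ 2 := by positivity
  have hg0 : 0 ≤ ∫ x in simplex K₁, ‖grad M u x‖ ^ 2 := by positivity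
  -- With `G₁` the gradient term on `K₁` and `S`, `D` the two stabilization terms, the total is `12τ
  -- G₁ + (12τ + 2) S + (6τ + 6) D`. As `τ ≥ 1`, each coefficient is at most `14τ`.
  generalize (2 * s ^ 2) ^ d = τ at *
  have f₁ := mul_le_mul_of_nonneg_left (a₁.trans (add_le_add_right
    (mul_le_mul_of_nonneg_left b₁ zero_le_two) _)) (zero_le_one.trans hτ)
  have f₂ := mul_le_mul_of_nonneg_left d₁ (zero_le_one.trans hτ)
  have f₃ := mul_le_mul_of_nonneg_right hτ hS0
  have f₄ := mul_le_mul_of_nonneg_right hτ hD0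
  have f₅ := mul_le_mul_of_nonneg_right hτ hg0
  linarith

theorem localStab_self_nonneg (Ω : Set (Pt d)) (M : Set (Finset (Pt d))) (K K' : Finset (Pt d))
    (u : Pt d → ℝ) : 0 ≤ localStab Ω M K K' u u := by
  rw [localStab_self]
  positivity

/-- Transfer of the `L²` norm of a finite element function between neighbouring cells by the
stabilization form. -/
theorem AffineOnCells.integral_sq_le_localStab {T : Geometry.SimplicialComplex ℝ (Pt d)}
    {M : Set (Finset (Pt d))} (hMT : M ⊆ cells T) (hM : M.Finite) (Ω : Set (Pt d))
    {v : Pt d → ℝ} (hv : AffineOnCells M v) {s h₀ : ℝ} {K₁ K₂ : Finset (Pt d)}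
    (h : ComparableCells s K₁ K₂) (hK₁ : K₁ ∈ M) (hK₂ : K₂ ∈ M) (hh₀ : cellDiam K₂ ≤ h₀) :
    ∫ x in simplex K₂, v x ^ 2 ≤
      (45 * (2 * s ^ 2) ^ d +
          (3 * (2 * s ^ 2) ^ d + 42 * (2 * s ^ 2) ^ d * s ^ 2) *
            (16 * (2 * s) ^ 2 * (4 * (2 * s)) ^ d)) *
        ((∫ x in simplex K₁, v x ^ 2) + h₀ ^ 2 * localStab Ω M K₁ K₂ v v) := by
  have hs := zero_le_one.trans h.one_le
  have k₁ := hv.integral_sq_le hM h hK₁ hK₂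
  have k₂ := hv.inverse_inequality hM h hK₁
  have k₃ := (hv.memH1 hM).integral_grad_sq_le hMT hM Ω h hK₁ hK₂
  have hS := localStab_self_nonneg Ω M K₁ K₂ v
  have hV : 0 ≤ ∫ x in simplex K₁, v x ^ 2 := by positivity
  have hE : 0 ≤ ∫ x in simplex K₁, ‖grad M v x‖ ^ 2 := by positivity
  have hτ : 0 ≤ (2 * s ^ 2) ^ d := by positivity
  have hκ : 0 ≤ 16 * (2 * s) ^ 2 * (4 * (2 * s)) ^ d := by positivity
  have d₀ : 0 ≤ cellDiam K₂ := Metric.diam_nonneg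
  have d₁ : cellDiam K₂ ^ 2 ≤ s ^ 2 * cellDiam K₁ ^ 2 :=
    (pow_le_pow_left₀ d₀ h.diam_le 2).trans_eq (mul_pow _ _ _)
  have d₂ : cellDiam K₂ ^ 2 ≤ h₀ ^ 2 := pow_le_pow_left₀ d₀ hh₀ 2
  generalize (2 * s ^ 2) ^ d = τ at *
  generalize 16 * (2 * s) ^ 2 * (4 * (2 * s)) ^ d = κ at *
  generalize ∫ x in simplex K₁, v x ^ 2 = V at *
  generalize ∫ x in simplex K₁, ‖grad M v x‖ ^ 2 = E at *
  generalize localStab Ω M K₁ K₂ v v = S at *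
  -- The factor `cellDiam K₂ ^ 2` is traded for `s ^ 2 * cellDiam K₁ ^ 2` in front of `E`, to match
  -- the inverse inequality on `K₁`, and for `h₀ ^ 2` in front of `S`.
  have m₁ : cellDiam K₂ ^ 2 * ∫ x in simplex K₂, ‖grad M v x‖ ^ 2 ≤
      14 * τ * (s ^ 2 * (κ * V) + h₀ ^ 2 * S) := by
    calc cellDiam K₂ ^ 2 * ∫ x in simplex K₂, ‖grad M v x‖ ^ 2
        ≤ cellDiam K₂ ^ 2 * (14 * τ * (E + S)) := by gcongr
      _ = 14 * τ * (cellDiam K₂ ^ 2 * E + cellDiam K₂ ^ 2 * S) := by ring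
      _ ≤ 14 * τ * (s ^ 2 * cellDiam K₁ ^ 2 * E + h₀ ^ 2 * S) := by gcongr
      _ = 14 * τ * (s ^ 2 * (cellDiam K₁ ^ 2 * E) + h₀ ^ 2 * S) := by ring
      _ ≤ _ := by gcongr
  have m₂ : τ * (cellDiam K₁ ^ 2 * E) ≤ τ * (κ * V) := by gcongr
  -- The bounds add up to `3τ V + (3τ + 42τ s²)κ V + 42τ h₀² S`. The coefficient `45τ` covers both
  -- `3τ` and `42τ`; these nonnegative terms are the slack.
  have n₁ : 0 ≤ τ * V := by positivity
  have n₂ : 0 ≤ τ * (h₀ ^ 2 * S) := by positivity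
  have n₃ : 0 ≤ (3 * τ + 42 * τ * s ^ 2) * κ * (h₀ ^ 2 * S) := by positivity
  linarith

/-! ### Neighbouring cells of a shape-regular mesh -/

/-- For `d ≥ 2` the common face contains an edge. Its length is at least the diameter of the ball
inscribed in `K₂` and at most `cellDiam K₁`, which gives `diam_le`. -/
theorem SharesFace.comparableCells {T : Geometry.SimplicialComplex ℝ (Pt d)}
    {M : Set (Finset (Pt d))} (hMT : M ⊆ cells T) (hd : 2 ≤ d) {σ : ℝ}
    (hσ : ShapeRegular T σ) {K₁ K₂ f : Finset (Pt d)} (hf : SharesFace M K₁ K₂ f) :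
    ComparableCells (max σ 1) K₁ K₂ := by
  obtain ⟨hK₁, hK₂, -, hcard, h₁, h₂⟩ := hf
  obtain ⟨v, hv, w, hw, hvw⟩ := Finset.one_lt_card.1 (show 1 < f.card by omega)
  have hball : ∀ K ∈ cells T, ∃ (c : Pt d) (r : ℝ), 0 < r ∧
      Metric.closedBall c r ⊆ simplex K ∧ cellDiam K ≤ max σ 1 * (2 * r) := by
    intro K hK
    obtain ⟨c, r, hr, hb, hle⟩ := hσ K hK
    refine ⟨c, r, hr, hb, hle.trans ?_⟩
    gcongr
    exact le_max_left _ _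
  have hmem : ∀ {K : Finset (Pt d)} {z : Pt d}, z ∈ K → z ∈ simplex K :=
    fun hz => subset_convexHull ℝ _ hz
  refine ⟨le_max_right _ _, ⟨v, hmem (h₁ hv), hmem (h₂ hv)⟩, hball K₁ (hMT hK₁), ?_⟩
  obtain ⟨c, r, hr, hb, hle⟩ := hball K₂ (hMT hK₂)
  refine hle.trans ?_
  gcongr
  calc 2 * r ≤ dist v w := two_mul_le_dist (T.indep (hMT hK₂).1) (hMT hK₂).2 hr.le hb (h₂ hv)
        (h₂ hw) hvw
    _ ≤ cellDiam K₁ := Metric.dist_le_diam_of_mem (isCompact_simplex K₁).isBounded (hmem (h₁ hv))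
        (hmem (h₁ hw))

theorem cellDiam_le_meshSize {T : Geometry.SimplicialComplex ℝ (Pt d)} (hT : (cells T).Finite)
    {K : Finset (Pt d)} (hK : K ∈ cells T) : cellDiam K ≤ meshSize T :=
  le_csSup (hT.image _).bddAbove (mem_image_of_mem _ hK)

end PG

end

theorem lemma4p2 (d : ℕ) (hd : d = 2 ∨ d = 3) (σ : ℝ) :
    ∃ c₀ c₁ : ℝ, 0 < c₀ ∧ 0 < c₁ ∧
      ∀ (Ω Ωk : Set (PG.Pt d)) (T : Geometry.SimplicialComplex ℝ (PG.Pt d)) (δ : ℝ),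
        IsOpen Ω → interior (closure Ω) = Ω → Ωk ⊆ Ω → Ωk.Nonempty → 0 ≤ δ →
        PG.IsTriangulation T Ω → PG.ShapeRegular T σ →
        ∀ K₁ K₂ f : Finset (PG.Pt d), PG.SharesFace (PG.subMesh T Ωk δ) K₁ K₂ f →
          (∀ u : PG.Pt d → ℝ, PG.MemH1 (PG.region (PG.subMesh T Ωk δ)) u →
            c₁ * ∫ x in PG.simplex K₂, ‖PG.grad (PG.subMesh T Ωk δ) u x‖ ^ 2 ≤
              (∫ x in PG.simplex K₁, ‖PG.grad (PG.subMesh T Ωk δ) u x‖ ^ 2) +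
                PG.localStab Ω (PG.subMesh T Ωk δ) K₁ K₂ u u) ∧
          (∀ v ∈ PG.feSpace Ω (PG.subMesh T Ωk δ),
            c₀ * ∫ x in PG.simplex K₂, v x ^ 2 ≤
              (∫ x in PG.simplex K₁, v x ^ 2) +
                PG.meshSize T ^ 2 * PG.localStab Ω (PG.subMesh T Ωk δ) K₁ K₂ v v) := by
  have hd2 : 2 ≤ d := by omega
  -- `σ` is an arbitrary real number; replacing it by `max σ 1` weakens shape regularity, makes the
  -- constants positive and ensures `1 ≤ (2 * s ^ 2) ^ d`.
  set s : ℝ := max σ 1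
  have hs : 0 < s := lt_max_of_lt_right one_pos
  set C₁ : ℝ := 14 * (2 * s ^ 2) ^ d
  set C₀ : ℝ := 45 * (2 * s ^ 2) ^ d +
    (3 * (2 * s ^ 2) ^ d + 42 * (2 * s ^ 2) ^ d * s ^ 2) * (16 * (2 * s) ^ 2 * (4 * (2 * s)) ^ d)
  have hC₁ : 0 < C₁ := by positivity
  have hC₀ : 0 < C₀ := by positivity
  refine ⟨C₀⁻¹, C₁⁻¹, inv_pos.2 hC₀, inv_pos.2 hC₁, ?_⟩
  intro Ω Ωk T δ _ _ _ _ _ hT hσ K₁ K₂ f hf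
  have hMT : PG.subMesh T Ωk δ ⊆ PG.cells T := fun K hK => hK.1
  have hTfin : (PG.cells T).Finite := hT.finite.subset fun K hK => hK.1
  have hM := hTfin.subset hMT
  have hcmp := hf.comparableCells hMT hd2 hσ
  refine ⟨fun u hu => ?_, fun v hv => ?_⟩
  · rw [inv_mul_le_iff₀ hC₁]
    exact hu.integral_grad_sq_le hMT hM Ω hcmp hf.1 hf.2.1
  · rw [inv_mul_le_iff₀ hC₀]
    exact PG.AffineOnCells.integral_sq_le_localStab hMT hM Ω hv.2.1 hcmp hf.1 hf.2.1
      (PG.cellDiam_le_meshSize hTfin (hMT hf.2.1))
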